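/- Let $\phi$ be a CNF formula, i.e. a finite set of clauses, each a finite set of literals. Its signed graph $F_\phi$ has as vertices the variables occurring in $\phi$ and the clauses of $\phi$; a variable $w$ and a clause $c$ are joined by a positive edge iff $w\in c$ and by a negative edge iff $\neg w\in c$. For a graph $G$ and $U\subseteq V(G)$ let $\rho_G(U)$ be the rank over $\mathrm{GF}(2)$ of the $U\times(V(G)\setminus U)$ submatrix of the adjacency matrix of $G$. The signed rank-width $\mathrm{rwd}(\phi)$ is the branch-width of the function $U\mapsto\rho_{F_\phi^+}(U)+\rho_{F_\phi^-}(U)$ on subsets of $V(F_\phi)$, i.e. the minimum, over all finite trees $T$ of maximum degree at most $3$ with a bijection from $V(F_\phi)$ to the leaves of $T$, of the maximum value of this function over the bipartitions of $V(F_\phi)$ induced by the edges of $T$. The signed clique-width $\mathrm{cwd}(\phi)$ is the least $k$ such that $F_\phi$ can be built, up to isomorphism, from single vertices with labels in $\{1,\dots,k\}$ by disjoint union, relabelling all labels $i$ to $j$, adding all positive edges between labels $i\ne j$, and adding all negative edges between labels $i\neq j$. (The tree consisting of one node has that node as its leaf; both widths are $0$ for the formula without clauses.) Then: a) for every CNF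 formula $\phi$, $\mathrm{rwd}(\phi)\le 2\,\mathrm{cwd}(\phi)$; b) there exist CNF formulas $\phi$ of arbitrarily large signed rank-width, without a clause that contains a variable together with its negation, such that $\mathrm{cwd}(\phi)\ge 2^{\mathrm{rwd}(\phi)/4-1}$. -/

import Mathlib

/-! ### Signed graphs and their cut-rank -/

/-- A signed graph on `V`: a graph with two edge sets, the positive and the negative edges.
Disjointness of the two edge sets is not required: it fails only for formulas with a clause that
contains a variable together with its negation. -/
structure SignedGraph (V : Type*) where
  /-- the graph of positive edges -/
  pos : SimpleGraph V
  /-- the graph of negative edges -/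
  neg : SimpleGraph V

open scoped Classical in
/-- The cut-rank of `U` in `G`: the rank over `GF(2)` of the submatrix of the adjacency matrix
with rows indexed by `U` and columns indexed by the complement of `U`. -/
noncomputable def SimpleGraph.cutRank {V : Type*} [Fintype V] (G : SimpleGraph V) (U : Set V) :
    ℕ :=
  ((G.adjMatrix (ZMod 2)).submatrix (fun u : U => (u : V))
    (fun w : (Uᶜ : Set V) => (w : V))).rank

/-- The signed cut-rank: the sum of the cut-ranks of the positive and of the negative graph. -/
noncomputable def SignedGraph.cutRank {V : Type*} [Fintype V] (G : SignedGraph V) (U : Set V) :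
    ℕ :=
  G.pos.cutRank U + G.neg.cutRank U

/-! ### Branch-width -/

/-- A branch-decomposition of a ground set `M`: a finite subcubic tree together with a bijection
of `M` onto the leaves of the tree. (The only node of a one-node tree counts as a leaf.) -/
structure BranchDecomposition (M : Type*) where
  /-- the nodes of the tree -/
  Node : Type
  fintypeNode : Fintype Node
  /-- the tree -/
  tree : SimpleGraph Node
  isTree : tree.IsTree
  subcubic : ∀ t, (tree.neighborSet t).ncard ≤ 3
  /-- the bijection onto the leaves -/
  leaf : M ≃ {t : Node // (tree.neighborSet t).ncard ≤ 1}

attribute [instance] BranchDecomposition.fintypeNode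

namespace BranchDecomposition

/-- For an edge `s t` of the tree, the elements of `M` whose leaf lies in the component of `s`
after the removal of the edge `s t`. -/
def side {M : Type*} (D : BranchDecomposition M) (s t : D.Node) : Set M :=
  {m | (D.tree.deleteEdges {s(s, t)}).Reachable s (D.leaf m : D.Node)}

open scoped Classical in
/-- The width of a branch-decomposition for the set function `f`: the maximum of `f` over the
edges of the tree. Every edge is taken in both directions, which makes no difference for a
symmetric `f`. The maximum over no edges is `0`. -/
noncomputable def width {M : Type*} (D : BranchDecomposition M) (f : Set M → ℕ) : ℕ :=
  Finset.univ.sup fun d : D.tree.Dart => f (D.side d.fst d.snd)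

end BranchDecomposition

/-- The branch-width of a (symmetric) set function: the minimum width of a branch-decomposition.
It is `0` for the empty ground set, which has no branch-decomposition. -/
noncomputable def branchWidth {M : Type*} (f : Set M → ℕ) : ℕ :=
  sInf {w | ∃ D : BranchDecomposition M, D.width f = w}

/-- The signed rank-width of a signed graph: the branch-width of the signed cut-rank. -/
noncomputable def SignedGraph.rankWidth {V : Type*} [Fintype V] (G : SignedGraph V) : ℕ :=
  branchWidth G.cutRank

/-! ### Signed clique-width -/

/-- A signed graph whose vertices carry one of `k` labels. -/
structure LabelledSignedGraph (k : ℕ) where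
  /-- the vertices -/
  V : Type
  /-- the signed graph -/
  graph : SignedGraph V
  /-- the labelling -/
  label : V → Fin k

/-- Signed `k`-expressions. -/
inductive SignedExpr (k : ℕ) : Type
  /-- a single vertex with label `i` -/
  | vertex (i : Fin k) : SignedExpr k
  /-- disjoint union -/
  | union (a b : SignedExpr k) : SignedExpr k
  /-- change all labels `i` to `j` -/
  | relabel (i j : Fin k) (a : SignedExpr k) : SignedExpr k
  /-- add all positive edges between label `i` and label `j` -/
  | joinPos (i j : Fin k) (hij : i ≠ j) (a : SignedExpr k) : SignedExpr k
  /-- add all negative edges between label `i` and label `j` -/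
  | joinNeg (i j : Fin k) (hij : i ≠ j) (a : SignedExpr k) : SignedExpr k

/-- All edges between a vertex with label `i` and a (different) vertex with label `j`. -/
def joinEdges {V : Type} {k : ℕ} (label : V → Fin k) (i j : Fin k) : SimpleGraph V :=
  SimpleGraph.fromRel fun u v => label u = i ∧ label v = j

/-- The labelled signed graph generated by a signed `k`-expression. -/
def SignedExpr.eval {k : ℕ} : SignedExpr k → LabelledSignedGraph k
  | .vertex i => ⟨Unit, ⟨⊥, ⊥⟩, fun _ => i⟩
  | .union a b =>
    ⟨a.eval.V ⊕ b.eval.V,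
      ⟨a.eval.graph.pos.sum b.eval.graph.pos, a.eval.graph.neg.sum b.eval.graph.neg⟩,
      Sum.elim a.eval.label b.eval.label⟩
  | .relabel i j a =>
    ⟨a.eval.V, a.eval.graph, fun v => if a.eval.label v = i then j else a.eval.label v⟩
  | .joinPos i j _ a =>
    ⟨a.eval.V, ⟨a.eval.graph.pos ⊔ joinEdges a.eval.label i j, a.eval.graph.neg⟩, a.eval.label⟩
  | .joinNeg i j _ a =>
    ⟨a.eval.V, ⟨a.eval.graph.pos, a.eval.graph.neg ⊔ joinEdges a.eval.label i j⟩, a.eval.label⟩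

/-- The expression `e` generates the signed graph `G`, up to isomorphism and with any final
labels. -/
def SignedExpr.Generates {k : ℕ} (e : SignedExpr k) {V : Type*} (G : SignedGraph V) : Prop :=
  ∃ f : e.eval.V ≃ V,
    (∀ u v, e.eval.graph.pos.Adj u v ↔ G.pos.Adj (f u) (f v)) ∧
    (∀ u v, e.eval.graph.neg.Adj u v ↔ G.neg.Adj (f u) (f v))

/-- The signed clique-width of a finite signed graph: the least `k` for which some signed
`k`-expression generates it. It is `0` for the graph without vertices, which has no
expression. -/
noncomputable def SignedGraph.cliqueWidth {V : Type*} (G : SignedGraph V) : ℕ :=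
  sInf {k | ∃ e : SignedExpr k, e.Generates G}

/-! ### CNF formulas -/

/-- A CNF formula over variables from `α`: a finite set of clauses, each a finite set of literals.
The literal `x` is `(x, true)` and the literal `¬ x` is `(x, false)`. -/
abbrev CNFFormula (α : Type*) := Finset (Finset (α × Bool))

namespace CNFFormula

variable {α : Type*}

/-- No clause contains a variable together with its negation. -/
def NoComplementaryLiterals (φ : CNFFormula α) : Prop :=
  ∀ c ∈ φ, ∀ x : α, ¬ ((x, true) ∈ c ∧ (x, false) ∈ c)

/-- The variables that occur in `φ`. -/
def Var (φ : CNFFormula α) : Type _ := {x : α // ∃ c ∈ φ, ∃ b : Bool, (x, b) ∈ c}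

/-- The clauses of `φ`. -/
def Clause (φ : CNFFormula α) : Type _ := {c : Finset (α × Bool) // c ∈ φ}

instance (φ : CNFFormula α) : Finite φ.Var := by
  classical
  refine Set.Finite.to_subtype (s := {x : α | ∃ c ∈ φ, ∃ b : Bool, (x, b) ∈ c}) ?_
  refine ((φ.biUnion id).image Prod.fst).finite_toSet.subset ?_
  rintro x ⟨c, hc, b, hb⟩
  simp only [Finset.coe_image, Set.mem_image, Finset.mem_coe, Finset.mem_biUnion, id_eq]
  exact ⟨(x, b), ⟨c, hc, hb⟩, rfl⟩

instance (φ : CNFFormula α) : Finite φ.Clause :=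
  inferInstanceAs (Finite {c : Finset (α × Bool) // c ∈ φ})

/-- The vertices of the signed graph of `φ`: the variables that occur in `φ` and the clauses. -/
abbrev Vertex (φ : CNFFormula α) : Type _ := φ.Var ⊕ φ.Clause

noncomputable instance (φ : CNFFormula α) : Fintype φ.Vertex := Fintype.ofFinite _

/-- The bipartite graph in which a variable `x` and a clause `c` are adjacent if and only if the
literal `(x, b)` occurs in `c`. -/
def literalGraph (φ : CNFFormula α) (b : Bool) : SimpleGraph φ.Vertex where
  Adj
    | .inl x, .inr c => (x.1, b) ∈ c.1
    | .inr c, .inl x => (x.1, b) ∈ c.1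
    | _, _ => False
  symm := ⟨by rintro (x | c) (y | d) h <;> exact h⟩
  loopless := ⟨by rintro (x | c) h <;> exact h⟩

/-- The signed graph of a CNF formula. -/
def signedGraph (φ : CNFFormula α) : SignedGraph φ.Vertex where
  pos := φ.literalGraph true
  neg := φ.literalGraph false

/-- The (signed) rank-width of a CNF formula. -/
noncomputable def rankWidth (φ : CNFFormula α) : ℕ := φ.signedGraph.rankWidth

/-- The signed clique-width of a CNF formula. -/
noncomputable def cliqueWidth (φ : CNFFormula α) : ℕ := φ.signedGraph.cliqueWidth

end CNFFormula

/-!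
Both parts rest on the number of different rows of the cut matrix of a set `U` of vertices
(`SimpleGraph.RowsLE`).

For the upper bound, the parse tree of a signed `k`-expression is read as a branch-decomposition
(`SignedExpr.Generates.exists_branchDecomposition`). An edge of the tree cuts off the vertices of a
subexpression; two of them that get the same label in the subexpression are never distinguished by
the vertices outside, so that for each sign the cut matrix has at most `k` different rows and rank
at most `k`.

For the lower bound, the variables are the nonzero vectors of `GF(2) ^ t` and there is one clause
for every vector `y`, which consists of the positive literals `x` with `x ⬝ᵥ y = 1`
(`CNFFormula.dotFormula`). The adjacency matrix factors through dimension `2 * t`, so every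
branch-decomposition has width at most `2 * t`. On the other hand, every branch-decomposition has
an edge with at least a third of the clauses on each side
(`BranchDecomposition.exists_balanced_edge`). One of the sides, say `U`, has at least
`2 ^ (t - 1)` of the variables, and if `A` is the set of these and `B` the set of clauses in the
complement of `U`, then the `A × B` submatrix of the cut matrix has at least `|A| * |B| / 2 ^ t` different rows: by
orthogonality, a set of `a` variables with equal rows on `B` satisfies `a * |B| ≤ 2 ^ t`. The same
bound holds with the roles of `U` and its complement, or of variables and clauses, exchanged. So
the cut has at least `2 ^ t / 6` different rows in both directions
(`SimpleGraph.IsDotProductGraph.two_pow_le_of_rowsLE`). In the tree of an expression this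
makes the number of labels at least `2 ^ t / 6`, and since a matrix of rank `r` over `GF(2)` has at
most `2 ^ r` different rows, it also forces the rank-width to be at least `t - 2`.
-/

/-! ### Cutting a tree at an edge -/

namespace SimpleGraph

variable {V : Type*} {G : SimpleGraph V}

/-- A set of vertices closed under adjacency contains everything reachable from its elements. -/
lemma Reachable.mem_of_closed {R : Set V} (hR : ∀ x y, x ∈ R → G.Adj x y → y ∈ R) {a b : V}
    (h : G.Reachable a b) (ha : a ∈ R) : b ∈ R := by
  obtain ⟨p⟩ := h
  induction p with
  | nil => exact ha
  | cons hadj _ ih => exact ih (hR _ _ ha hadj)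

variable (G) in
/-- The component of `s` after the removal of the edge `s t`. -/
def edgeSide (s t : V) : Set V := {w | (G.deleteEdges {s(s, t)}).Reachable s w}

lemma self_mem_edgeSide (s t : V) : s ∈ G.edgeSide s t := Reachable.refl _

lemma mem_edgeSide_of_adj {s t x y : V} (hx : x ∈ G.edgeSide s t) (h : G.Adj x y)
    (hne : s(x, y) ≠ s(s, t)) : y ∈ G.edgeSide s t :=
  Reachable.trans hx (Adj.reachable (by simpa [deleteEdges_adj] using ⟨h, by simpa using hne⟩))

/-- A set containing `s` and closed under all edges except `s t` contains the component of `s`. -/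
lemma edgeSide_subset {s t : V} {R : Set V} (hs : s ∈ R)
    (hR : ∀ x y, x ∈ R → G.Adj x y → s(x, y) ≠ s(s, t) → y ∈ R) : G.edgeSide s t ⊆ R := by
  intro w hw
  refine Reachable.mem_of_closed (fun x y hx h => ?_) hw hs
  rw [deleteEdges_adj] at h
  exact hR x y hx h.1 (by simpa using h.2)

lemma IsTree.notMem_edgeSide (hG : G.IsTree) {s t : V} (h : G.Adj s t) :
    t ∉ G.edgeSide s t :=
  isAcyclic_iff_forall_adj_isBridge.1 hG.isAcyclic h

lemma IsTree.edgeSide_compl (hG : G.IsTree) {s t : V} (h : G.Adj s t) :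
    (G.edgeSide s t)ᶜ = G.edgeSide t s := by
  have hcover : ∀ w, w ∈ G.edgeSide s t ∪ G.edgeSide t s := by
    intro w
    refine Reachable.mem_of_closed (G := G) ?_ (hG.connected.preconnected s w)
      (Or.inl (self_mem_edgeSide s t))
    intro x y hx hxy
    by_cases he : s(x, y) = s(s, t)
    · rcases Sym2.eq_iff.1 he with ⟨rfl, rfl⟩ | ⟨rfl, rfl⟩
      · exact Or.inr (self_mem_edgeSide _ _)
      · exact Or.inl (self_mem_edgeSide _ _)
    · exact hx.imp (fun hx => mem_edgeSide_of_adj hx hxy he)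
        (fun hx => mem_edgeSide_of_adj hx hxy (by rwa [Sym2.eq_swap (a := t)]))
  ext w
  refine ⟨fun hw => (hcover w).resolve_left hw, fun hw hw' => ?_⟩
  have h' : (G.deleteEdges {s(s, t)}).Reachable t w := by
    have : (G.deleteEdges {s(t, s)}).Reachable t w := hw
    rwa [Sym2.eq_swap] at this
  exact hG.notMem_edgeSide h (Reachable.trans hw' h'.symm)

/-- Past `s`, the component of `s` in `G - st` is covered by the components hanging at `s`. -/
lemma edgeSide_subset_iUnion (s t : V) :
    G.edgeSide s t ⊆ {s} ∪ ⋃ u ∈ G.neighborSet s \ {t}, G.edgeSide u s := by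
  refine edgeSide_subset (Or.inl rfl) fun x y hx hxy hne => ?_
  rcases hx with rfl | hx
  · have hyt : y ≠ t := by rintro rfl; exact hne rfl
    exact Or.inr (Set.mem_biUnion (show y ∈ G.neighborSet x \ {t} from ⟨hxy, hyt⟩)
      (self_mem_edgeSide _ _))
  · obtain ⟨u, hu, hxu⟩ := Set.mem_iUnion₂.1 hx
    by_cases he : s(x, y) = s(u, s)
    · rcases Sym2.eq_iff.1 he with ⟨rfl, rfl⟩ | ⟨rfl, rfl⟩
      · exact Or.inl rfl
      · exact Or.inr (Set.mem_biUnion hu (self_mem_edgeSide _ _))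
    · exact Or.inr (Set.mem_biUnion hu (mem_edgeSide_of_adj hxu hxy he))

lemma IsTree.edgeSide_ssubset (hG : G.IsTree) {s t u : V} (ht : G.Adj s t) (hu : G.Adj s u)
    (hut : u ≠ t) : G.edgeSide u s ⊂ G.edgeSide s t := by
  have hsub : G.edgeSide t s ⊆ G.edgeSide t s ∩ G.edgeSide s u := by
    refine edgeSide_subset ⟨self_mem_edgeSide _ _, mem_edgeSide_of_adj (self_mem_edgeSide _ _) ht
      (by simp [hut.symm, hu.ne])⟩ fun x y hx hxy hne => ?_
    have hy := mem_edgeSide_of_adj hx.1 hxy hne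
    refine ⟨hy, mem_edgeSide_of_adj hx.2 hxy fun he => ?_⟩
    have hs := hG.notMem_edgeSide ht.symm
    rcases Sym2.eq_iff.1 he with ⟨rfl, rfl⟩ | ⟨rfl, rfl⟩
    · exact hs hx.1
    · exact hs hy
  refine (Set.ssubset_iff_of_subset ?_).2 ⟨s, self_mem_edgeSide _ _, hG.notMem_edgeSide hu.symm⟩
  rw [← hG.edgeSide_compl hu, ← hG.edgeSide_compl ht.symm]
  exact Set.compl_subset_compl.2 fun w hw => (hsub hw).2

end SimpleGraph

/-! ### Balanced edges of a branch-decomposition -/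

namespace BranchDecomposition

open SimpleGraph

variable {M : Type*} (D : BranchDecomposition M)

lemma le_width (f : Set M → ℕ)
    {s t : D.Node} (h : D.tree.Adj s t) : f (D.side s t) ≤ D.width f := by
  classical
  unfold width
  exact Finset.le_sup (f := fun d : D.tree.Dart => f (D.side d.fst d.snd))
    (Finset.mem_univ ⟨(s, t), h⟩)

lemma width_le {f : Set M → ℕ} {w : ℕ}
    (h : ∀ s t, D.tree.Adj s t → f (D.side s t) ≤ w) : D.width f ≤ w := by
  unfold width
  exact Finset.sup_le fun d _ => h _ _ d.adj

lemma mem_side {s t : D.Node} {m : M} :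
    m ∈ D.side s t ↔ (D.leaf m : D.Node) ∈ D.tree.edgeSide s t := Iff.rfl

lemma side_compl {s t : D.Node} (h : D.tree.Adj s t) : (D.side s t)ᶜ = D.side t s := by
  ext m
  rw [mem_side, ← D.isTree.edgeSide_compl h]
  rfl

lemma ncard_inter_side_add {s t : D.Node} (h : D.tree.Adj s t) {S : Set M} (hS : S.Finite) :
    (S ∩ D.side s t).ncard + (S ∩ D.side t s).ncard = S.ncard := by
  rw [← D.side_compl h, ← Set.sdiff_eq, Set.ncard_inter_add_ncard_sdiff_eq_ncard S _ hS]

/-- If every branch hanging at `s`, except the one through `t`, has less than a third of `S`, then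
`s` and these branches together have at most two thirds of `S`. -/
lemma three_mul_ncard_inter_side_le {s t : D.Node} (h : D.tree.Adj s t) {S : Set M}
    (hS : S.Finite) (h4 : 4 ≤ S.ncard)
    (hu : ∀ u, D.tree.Adj s u → u ≠ t → 3 * (S ∩ D.side u s).ncard < S.ncard) :
    3 * (S ∩ D.side s t).ncard ≤ 2 * S.ncard := by
  classical
  have hcov : S ∩ D.side s t ⊆
      {m | (D.leaf m : D.Node) = s} ∪ ⋃ u ∈ D.tree.neighborSet s \ {t}, S ∩ D.side u s := by
    rintro m ⟨hmS, hm⟩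
    rcases D.tree.edgeSide_subset_iUnion s t hm with hm | hm
    · exact Or.inl hm
    · obtain ⟨u, hu, hm⟩ := Set.mem_iUnion₂.1 hm
      exact Or.inr (Set.mem_biUnion hu ⟨hmS, hm⟩)
  have hfin : (D.tree.neighborSet s).Finite := Set.toFinite _
  have hcard : (D.tree.neighborSet s \ {t}).ncard = (D.tree.neighborSet s).ncard - 1 :=
    Set.ncard_sdiff_singleton_of_mem h
  by_cases hleaf : (D.tree.neighborSet s).ncard ≤ 1
  · have hempty : D.tree.neighborSet s \ {t} = ∅ := by
      rw [← Set.ncard_eq_zero (Set.toFinite _)]; omega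
    rw [hempty] at hcov
    simp only [Set.biUnion_empty, Set.union_empty] at hcov
    have : (S ∩ D.side s t).ncard ≤ 1 := by
      rw [Set.ncard_le_one (hS.subset Set.inter_subset_left)]
      intro a ha b hb
      exact D.leaf.injective (Subtype.ext ((hcov ha).trans (hcov hb).symm))
    omega
  · have hnone : {m | (D.leaf m : D.Node) = s} = ∅ := by
      ext m
      simp only [Set.mem_ofPred_eq, Set.mem_empty_iff_false, iff_false]
      rintro rfl
      exact hleaf (D.leaf m).2
    rw [hnone, Set.empty_union] at hcov
    set T : Finset D.Node := (Set.toFinite (D.tree.neighborSet s \ {t})).toFinset with hT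
    have hTcard : T.card ≤ 2 := by
      rw [hT, ← Set.ncard_eq_toFinset_card, hcard]
      have := D.subcubic s
      omega
    have hle : (S ∩ D.side s t).ncard ≤ ∑ u ∈ T, (S ∩ D.side u s).ncard := by
      refine (Set.ncard_le_ncard (t := ⋃ u ∈ T, S ∩ D.side u s) (fun m hm => ?_)
        (hS.subset (Set.iUnion₂_subset fun _ _ => Set.inter_subset_left))).trans
        (Finset.set_ncard_biUnion_le _ _)
      obtain ⟨u, hu, hm⟩ := Set.mem_iUnion₂.1 (hcov hm)
      exact Set.mem_biUnion (by simpa [hT] using hu) hm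
    calc 3 * (S ∩ D.side s t).ncard ≤ ∑ u ∈ T, 3 * (S ∩ D.side u s).ncard := by
          rw [← Finset.mul_sum]; omega
      _ ≤ ∑ _u ∈ T, S.ncard := Finset.sum_le_sum fun u hu' => by
          have : u ∈ D.tree.neighborSet s \ {t} := by simpa [hT] using hu'
          exact (hu u this.1 this.2).le
      _ ≤ 2 * S.ncard := by
          rw [Finset.sum_const, smul_eq_mul]; exact Nat.mul_le_mul_right _ hTcard

/-- Every branch-decomposition has an edge with at least a third of a given set on each side. -/
lemma exists_balanced_edge {S : Set M} (hS : S.Finite) (h4 : 4 ≤ S.ncard) :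
    ∃ s t, D.tree.Adj s t ∧ S.ncard ≤ 3 * (S ∩ D.side s t).ncard ∧
      S.ncard ≤ 3 * (S ∩ D.side t s).ncard := by
  classical
  -- Among the edges directed away from at least a third of `S`, take one that cuts off the
  -- fewest nodes.
  let heavy : Set (D.Node × D.Node) :=
    {p | D.tree.Adj p.1 p.2 ∧ S.ncard ≤ 3 * (S ∩ D.side p.1 p.2).ncard}
  have hne : heavy.Nonempty := by
    obtain ⟨a, ha, b, hb, hab⟩ := (Set.one_lt_ncard hS).1 (by omega)
    have : Nontrivial D.Node :=
      ⟨D.leaf a, D.leaf b, fun h => hab (D.leaf.injective (Subtype.ext h))⟩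
    obtain ⟨t, ht⟩ := D.isTree.connected.preconnected.exists_adj_of_nontrivial (D.leaf a : D.Node)
    have hsum := D.ncard_inter_side_add ht hS
    by_cases hc : S.ncard ≤ 3 * (S ∩ D.side (D.leaf a) t).ncard
    · exact ⟨(_, _), ht, hc⟩
    · have hc' : S.ncard ≤ 3 * (S ∩ D.side t (D.leaf a)).ncard := by omega
      exact ⟨(_, _), ht.symm, hc'⟩
  obtain ⟨⟨s, t⟩, hmem, hmin⟩ := Set.exists_min_image heavy
    (fun p => (D.tree.edgeSide p.1 p.2).ncard) (Set.toFinite _) hne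
  have hst : D.tree.Adj s t := hmem.1
  have hheavy : S.ncard ≤ 3 * (S ∩ D.side s t).ncard := hmem.2
  refine ⟨s, t, hst, hheavy, ?_⟩
  have hle := D.three_mul_ncard_inter_side_le hst hS h4 fun u hu hut => by
    by_contra! hcon
    have h1 : (D.tree.edgeSide s t).ncard ≤ (D.tree.edgeSide u s).ncard :=
      hmin (u, s) ⟨hu.symm, hcon⟩
    have h2 := Set.ncard_lt_ncard (D.isTree.edgeSide_ssubset hst hu hut) (Set.toFinite _)
    omega
  have hsum := D.ncard_inter_side_add hst hS
  omega

end BranchDecomposition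

/-! ### Branch-decompositions from binary addresses -/

/-- A binary tree with leaf set `M`, given by the address `addr m` of each leaf `m`: the sequence
of turns on the way to `m`, where `List.cons` appends the last turn, so that the ancestors of a
node are the suffixes of its address. Different leaves have incomparable addresses, and the root is
a leaf or has two children. -/
structure LeafAddress (M : Type*) where
  /-- the address of a leaf -/
  addr : M → List Bool
  eq_of_suffix : ∀ m m', addr m <:+ addr m' → m = m'
  root_branches : ∀ m, addr m ≠ [] → ∀ b, ∃ m', [b] <:+ addr m'

namespace LeafAddress

open SimpleGraph

variable {M : Type*} (A : LeafAddress M)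

/-- The nodes of the tree are the addresses of the leaves and of their ancestors. -/
abbrev Node : Type := {a : List Bool // ∃ m, a <:+ A.addr m}

/-- The leaves below the node with address `a`. -/
def below (a : List Bool) : Set M := {m | a <:+ A.addr m}

/-- Every node other than the root is joined to its parent, whose address is the tail. -/
def tree : SimpleGraph A.Node where
  Adj x y := (∃ b, y.1 = b :: x.1) ∨ ∃ b, x.1 = b :: y.1
  symm := ⟨fun _ _ h => h.symm⟩
  loopless := ⟨fun x h => by rcases h with ⟨b, h⟩ | ⟨b, h⟩ <;> simp at h⟩

instance [Finite M] : Finite A.Node := by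
  refine Set.Finite.to_subtype (s := {a | ∃ m, a <:+ A.addr m}) ?_
  refine (Set.finite_iUnion fun m => (A.addr m).tails.finite_toSet).subset ?_
  rintro a ⟨m, hm⟩
  exact Set.mem_iUnion.2 ⟨m, (List.mem_tails _ _).2 hm⟩

/-- The parent of a node. -/
def parent (b : Bool) (a : List Bool) (h : ∃ m, b :: a <:+ A.addr m) : A.Node :=
  ⟨a, h.imp fun _ hm => (List.suffix_cons b a).trans hm⟩

lemma edgeSide_child {p c : A.Node} {b : Bool} (h : c.1 = b :: p.1) :
    A.tree.edgeSide c p = {x | c.1 <:+ x.1} := by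
  apply Set.Subset.antisymm
  · refine edgeSide_subset List.suffix_rfl ?_
    rintro x y hx (⟨d, hd⟩ | ⟨d, hd⟩) hne
    · exact (hd ▸ (hx : c.1 <:+ x.1).trans (List.suffix_cons d x.1) : c.1 <:+ y.1)
    · have hx' : c.1 <:+ d :: y.1 := hd ▸ hx
      rcases List.suffix_cons_iff.1 hx' with he | he
      · refine absurd ?_ hne
        have hyp : y = p := Subtype.ext (by rw [h] at he; exact (List.cons.inj he).2.symm)
        have hxc : x = c := Subtype.ext (by rw [hd, he])
        rw [hyp, hxc]
      · exact he
  · rintro ⟨x, hxm⟩ hx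
    change c.1 <:+ x at hx
    induction x with
    | nil => rw [h] at hx; simp at hx
    | cons d y ih =>
      rcases List.suffix_cons_iff.1 hx with he | he
      · have : (⟨d :: y, hxm⟩ : A.Node) = c := Subtype.ext he.symm
        rw [this]
        exact self_mem_edgeSide _ _
      · refine mem_edgeSide_of_adj (ih (A.parent d y hxm).2 he) (Or.inl ⟨d, rfl⟩) fun hs => ?_
        have hlen : c.1.length ≤ y.length := he.length_le
        rcases Sym2.eq_iff.1 hs with ⟨-, h2⟩ | ⟨h1, -⟩
        · have : p.1 = d :: y := congrArg Subtype.val h2.symm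
          rw [h, this] at hlen
          simp at hlen
        · have : p.1 = y := congrArg Subtype.val h1.symm
          rw [h, this] at hlen
          simp at hlen

lemma isTree [Nonempty M] : A.tree.IsTree := by
  have hroot : ∃ m, [] <:+ A.addr m := ⟨Classical.arbitrary M, List.nil_suffix⟩
  have hreach : ∀ x : A.Node, A.tree.Reachable ⟨[], hroot⟩ x := by
    rintro ⟨x, hx⟩
    induction x with
    | nil => exact Reachable.refl _
    | cons d y ih =>
      exact (ih (A.parent d y hx).2).trans (Adj.reachable (Or.inl ⟨d, rfl⟩))
  refine ⟨@Connected.mk _ _ (fun x y => (hreach x).symm.trans (hreach y)) ⟨⟨[], hroot⟩⟩, ?_⟩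
  have hbridge : ∀ c p : A.Node, (∃ b, c.1 = b :: p.1) → p ∉ A.tree.edgeSide c p := by
    rintro c p ⟨b, h⟩
    rw [A.edgeSide_child h]
    intro hcp
    have := List.IsSuffix.length_le (show c.1 <:+ p.1 from hcp)
    rw [h] at this
    simp at this
  rw [isAcyclic_iff_forall_adj_isBridge]
  rintro x y (h | h)
  · rw [Sym2.eq_swap]
    exact hbridge y x h
  · exact hbridge x y h

lemma ncard_neighborSet_le_three (x : A.Node) : (A.tree.neighborSet x).ncard ≤ 3 := by
  have hsub : Subtype.val '' A.tree.neighborSet x ⊆ {x.1.tail, true :: x.1, false :: x.1} := by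
    rintro _ ⟨y, ⟨b, h⟩ | ⟨b, h⟩, rfl⟩
    · cases b <;> simp [h]
    · simp [h]
  rw [← Set.ncard_image_of_injective _ Subtype.val_injective]
  refine (Set.ncard_le_ncard hsub (Set.toFinite _)).trans ?_
  exact (Set.ncard_insert_le _ _).trans (Nat.succ_le_succ
    ((Set.ncard_insert_le _ _).trans (by simp)))

lemma ncard_neighborSet_addr_le_one (m : M) :
    (A.tree.neighborSet ⟨A.addr m, m, List.suffix_rfl⟩).ncard ≤ 1 := by
  have hsub : Subtype.val '' A.tree.neighborSet ⟨A.addr m, m, List.suffix_rfl⟩ ⊆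
      {(A.addr m).tail} := by
    rintro _ ⟨⟨y, m', hm'⟩, ⟨b, h⟩ | ⟨b, h⟩, rfl⟩
    · change y = b :: A.addr m at h
      rw [h] at hm'
      obtain rfl := A.eq_of_suffix m m' ((List.suffix_cons b _).trans hm')
      have := hm'.length_le
      simp at this
    · change A.addr m = b :: y at h
      simp [h]
  rw [← Set.ncard_image_of_injective _ Subtype.val_injective]
  exact (Set.ncard_le_ncard hsub (Set.toFinite _)).trans (by simp)

lemma exists_addr_eq_of_ncard_le_one [Finite M] (x : A.Node)
    (hx : (A.tree.neighborSet x).ncard ≤ 1) : ∃ m, A.addr m = x.1 := by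
  obtain ⟨x, m, hm⟩ := x
  by_contra! hne
  rw [Set.ncard_le_one (Set.toFinite _)] at hx
  obtain ⟨l, hl⟩ := hm
  rcases List.eq_nil_or_concat' l with rfl | ⟨l, b, rfl⟩
  · exact hne m hl.symm
  have hb : b :: x <:+ A.addr m := ⟨l, by simpa using hl⟩
  cases x with
  | nil =>
    obtain ⟨m₁, h₁⟩ := A.root_branches m (by rintro h; simp [h] at hb) true
    obtain ⟨m₂, h₂⟩ := A.root_branches m (by rintro h; simp [h] at hb) false
    have := hx ⟨[true], m₁, h₁⟩ (Or.inl ⟨true, rfl⟩) ⟨[false], m₂, h₂⟩ (Or.inl ⟨false, rfl⟩)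
    simp at this
  | cons d y =>
    have hy := (A.parent d y ⟨m, (List.suffix_cons b _).trans hb⟩).2
    have := hx ⟨b :: d :: y, m, hb⟩ (Or.inl ⟨b, rfl⟩) ⟨y, hy⟩ (Or.inr ⟨d, rfl⟩)
    have := congrArg (fun z : A.Node => z.1.length) this
    simp at this
    omega

/-- The branch-decomposition whose tree has the given leaf addresses. -/
noncomputable def toBranchDecomposition [Finite M] [Nonempty M] : BranchDecomposition M where
  Node := A.Node
  fintypeNode := Fintype.ofFinite _
  tree := A.tree
  isTree := A.isTree
  subcubic := A.ncard_neighborSet_le_three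
  leaf := Equiv.ofBijective (fun m => ⟨⟨A.addr m, m, List.suffix_rfl⟩,
    A.ncard_neighborSet_addr_le_one m⟩) (by
      refine ⟨fun m m' h => ?_, fun x => ?_⟩
      · have h' : A.addr m = A.addr m' := congrArg (fun z => z.1.1) h
        exact A.eq_of_suffix m m' (h' ▸ List.suffix_rfl)
      · obtain ⟨m, hm⟩ := A.exists_addr_eq_of_ncard_le_one x.1 x.2
        exact ⟨m, Subtype.ext (Subtype.ext hm)⟩)

/-- One side of every edge of the tree is the set of leaves below some node. -/
lemma exists_side_eq_below [Finite M] [Nonempty M] {s t : A.toBranchDecomposition.Node}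
    (h : A.toBranchDecomposition.tree.Adj s t) :
    ∃ a, A.toBranchDecomposition.side s t = A.below a ∨
      A.toBranchDecomposition.side t s = A.below a := by
  have key : ∀ c p : A.Node, (∃ b, c.1 = b :: p.1) →
      A.toBranchDecomposition.side c p = A.below c.1 := by
    rintro c p ⟨b, h⟩
    ext m
    exact Set.ext_iff.1 (A.edgeSide_child h) ⟨A.addr m, m, List.suffix_rfl⟩
  rcases h with h | h
  · exact ⟨_, Or.inr (key t s h)⟩
  · exact ⟨_, Or.inl (key s t h)⟩

end LeafAddress

/-! ### Cuts with few rows -/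

namespace SimpleGraph

variable {V : Type*}

/-- The rows of the cut matrix of `U` take at most `k` values: the vertices of `U` can be given
`k` labels such that vertices with the same label have the same neighbours outside of `U`. -/
def RowsLE (G : SimpleGraph V) (U : Set V) (k : ℕ) : Prop :=
  ∃ lab : V → Fin k, ∀ u ∈ U, ∀ v ∈ U, lab u = lab v → ∀ w ∉ U, (G.Adj u w ↔ G.Adj v w)

open scoped Classical in
/-- The `U × Uᶜ` submatrix of the adjacency matrix over `GF(2)`. -/
noncomputable def cutMatrix (G : SimpleGraph V) (U : Set V) :
    Matrix U (Uᶜ : Set V) (ZMod 2) :=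
  Matrix.of fun u w => if G.Adj u w then 1 else 0

lemma cutMatrix_eq_iff (G : SimpleGraph V) {U : Set V} {u v : U} {w : (Uᶜ : Set V)} :
    G.cutMatrix U u w = G.cutMatrix U v w ↔ (G.Adj u w ↔ G.Adj v w) := by
  simp only [cutMatrix, Matrix.of_apply]
  by_cases h1 : G.Adj u w <;> by_cases h2 : G.Adj v w <;> simp [h1, h2]

variable [Fintype V] (G : SimpleGraph V)

lemma cutRank_eq_rank_cutMatrix (U : Set V) [Fintype (Uᶜ : Set V)] :
    G.cutRank U = (G.cutMatrix U).rank := by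
  unfold cutRank
  congr!

lemma cutRank_compl (U : Set V) : G.cutRank Uᶜ = G.cutRank U := by
  classical
  rw [cutRank_eq_rank_cutMatrix, cutRank_eq_rank_cutMatrix, ← Matrix.rank_transpose,
    ← Matrix.rank_reindex (Equiv.setCongr (compl_compl U)) (Equiv.refl _)]
  congr 1
  ext u w
  simp [Matrix.reindex_apply, cutMatrix, G.adj_comm]

lemma cutRank_of_isEmpty [IsEmpty V] (U : Set V) : G.cutRank U = 0 := by
  classical
  have h := (G.cutMatrix U).rank_le_card_width
  rw [← cutRank_eq_rank_cutMatrix, Fintype.card_eq_zero] at h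
  exact Nat.le_zero.1 h

lemma cutRank_bot (U : Set V) : (⊥ : SimpleGraph V).cutRank U = 0 := by
  classical
  rw [cutRank_eq_rank_cutMatrix, show (⊥ : SimpleGraph V).cutMatrix U = 0 by ext; simp [cutMatrix],
    Matrix.rank_zero]

variable {G}

lemma RowsLE.cutRank_le {U : Set V} {k : ℕ} (h : G.RowsLE U k) : G.cutRank U ≤ k := by
  classical
  obtain ⟨lab, hlab⟩ := h
  let B : Matrix (Fin k) (Uᶜ : Set V) (ZMod 2) :=
    Matrix.of fun l w => if ∃ u ∈ U, lab u = l ∧ G.Adj u w then 1 else 0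
  have hB : G.cutMatrix U = B.submatrix (fun u : U => lab u) id := by
    ext u w
    simp only [cutMatrix, Matrix.submatrix_apply, B, Matrix.of_apply, id]
    refine if_congr ⟨fun h => ⟨u, u.2, rfl, h⟩, ?_⟩ rfl rfl
    rintro ⟨v, hv, hvu, hadj⟩
    exact (hlab v hv u u.2 hvu w w.2).1 hadj
  rw [cutRank_eq_rank_cutMatrix, hB]
  exact (Matrix.rank_submatrix_le _ _ _).trans (B.rank_le_card_height.trans_eq (Fintype.card_fin k))

/-- A matrix of rank `r` over a field with two elements has at most `2 ^ r` different rows. -/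
lemma rowsLE_two_pow_cutRank (U : Set V) : G.RowsLE U (2 ^ G.cutRank U) := by
  classical
  let R := Submodule.span (ZMod 2) (Set.range (G.cutMatrix U).row)
  have : Fintype R := Fintype.ofFinite _
  have hcard : Fintype.card R = 2 ^ G.cutRank U := by
    rw [Module.card_eq_pow_finrank (K := ZMod 2), ZMod.card, ← Matrix.rank_eq_finrank_span_row,
      cutRank_eq_rank_cutMatrix]
  let row : V → R := fun u => if hu : u ∈ U then
    ⟨(G.cutMatrix U).row ⟨u, hu⟩, Submodule.subset_span ⟨_, rfl⟩⟩ else 0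
  refine ⟨fun u => Fintype.equivFinOfCardEq hcard (row u), fun u hu v hv h w hw => ?_⟩
  have h' := (Fintype.equivFinOfCardEq hcard).injective h
  simp only [row, hu, hv, dif_pos, Subtype.mk.injEq] at h'
  exact G.cutMatrix_eq_iff.1 (congrFun h' ⟨w, hw⟩)

end SimpleGraph

/-! ### Signed expressions -/

namespace SignedExpr

variable {k : ℕ}

/-- The address of a vertex in the parse tree of an expression. Only disjoint unions branch. -/
def addr : (e : SignedExpr k) → e.eval.V → List Bool
  | .vertex _ => fun _ => []
  | .union a b => Sum.elim (fun v => a.addr v ++ [true]) (fun v => b.addr v ++ [false])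
  | .relabel _ _ a => a.addr
  | .joinPos _ _ _ a => a.addr
  | .joinNeg _ _ _ a => a.addr

lemma nonempty_eval_V (e : SignedExpr k) : Nonempty e.eval.V := by
  induction e with
  | vertex i => exact ⟨()⟩
  | union a b iha _ => exact iha.map Sum.inl
  | relabel _ _ a ih => exact ih
  | joinPos _ _ _ a ih => exact ih
  | joinNeg _ _ _ a ih => exact ih

lemma append_singleton_suffix_append_singleton {a b : List Bool} {x y : Bool} :
    a ++ [x] <:+ b ++ [y] ↔ a <:+ b ∧ x = y := by
  rw [← List.reverse_prefix]
  simp [List.cons_prefix_cons, and_comm]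

lemma eq_of_addr_suffix (e : SignedExpr k) (u v : e.eval.V) (h : e.addr u <:+ e.addr v) :
    u = v := by
  induction e with
  | vertex i => rfl
  | union a b iha ihb =>
    rcases u with u | u <;> rcases v with v | v
    all_goals
      simp only [addr, Sum.elim_inl, Sum.elim_inr,
        append_singleton_suffix_append_singleton] at h
    · rw [iha u v h.1]
    · simp at h
    · simp at h
    · rw [ihb u v h.1]
  | relabel _ _ a ih => exact ih u v h
  | joinPos _ _ _ a ih => exact ih u v h
  | joinNeg _ _ _ a ih => exact ih u v h

lemma exists_suffix_addr (e : SignedExpr k) (u : e.eval.V) (h : e.addr u ≠ []) (b : Bool) :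
    ∃ v, [b] <:+ e.addr v := by
  induction e with
  | vertex i => exact absurd rfl h
  | union a₁ a₂ _ _ =>
    obtain ⟨v₁⟩ := a₁.nonempty_eval_V
    obtain ⟨v₂⟩ := a₂.nonempty_eval_V
    cases b
    · exact ⟨Sum.inr v₂, List.suffix_append _ _⟩
    · exact ⟨Sum.inl v₁, List.suffix_append _ _⟩
  | relabel _ _ a ih => exact ih u h
  | joinPos _ _ _ a ih => exact ih u h
  | joinNeg _ _ _ a ih => exact ih u h

lemma joinEdges_adj_congr {V : Type} {label : V → Fin k} {i j : Fin k} {u v w : V}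
    (h : label u = label v) (hu : u ≠ w) (hv : v ≠ w) :
    (joinEdges label i j).Adj u w ↔ (joinEdges label i j).Adj v w := by
  simp [joinEdges, hu, hv, h]

/-- The vertices of a subexpression have a label for which vertices with the same label have the
same neighbours outside of the subexpression, in both graphs: the label that they carry in the
value of the subexpression. That label determines the label in the value of the whole expression,
so the property survives the operations outside of the subexpression. -/
lemma exists_label_below (e : SignedExpr k) (s : List Bool) :
    ∃ lab : e.eval.V → Fin k, ∀ u v, s <:+ e.addr u → s <:+ e.addr v → lab u = lab v →
      e.eval.label u = e.eval.label v ∧ ∀ w, ¬ s <:+ e.addr w →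
        (e.eval.graph.pos.Adj u w ↔ e.eval.graph.pos.Adj v w) ∧
        (e.eval.graph.neg.Adj u w ↔ e.eval.graph.neg.Adj v w) := by
  induction e generalizing s with
  | vertex i => exact ⟨fun _ => i, fun u v _ _ _ => ⟨rfl, fun w _ => ⟨Iff.rfl, Iff.rfl⟩⟩⟩
  | union a₁ a₂ ih₁ ih₂ =>
    rcases List.eq_nil_or_concat' s with rfl | ⟨s, b, rfl⟩
    · exact ⟨(union a₁ a₂).eval.label,
        fun u v _ _ h => ⟨h, fun w hw => absurd List.nil_suffix hw⟩⟩
    cases b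
    · obtain ⟨lab, hlab⟩ := ih₂ s
      refine ⟨Sum.elim a₁.eval.label lab, ?_⟩
      rintro (u | u) (v | v) hu hv h
      all_goals
        simp only [addr, Sum.elim_inl, Sum.elim_inr, append_singleton_suffix_append_singleton,
          Bool.false_eq_true, and_false, and_true] at hu hv
      refine ⟨(hlab u v hu hv h).1, ?_⟩
      rintro (w | w) hw
      · simp [eval]
      · exact (hlab u v hu hv h).2 w fun hw' =>
          hw (append_singleton_suffix_append_singleton.2 ⟨hw', rfl⟩)
    · obtain ⟨lab, hlab⟩ := ih₁ s
      refine ⟨Sum.elim lab a₂.eval.label, ?_⟩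
      rintro (u | u) (v | v) hu hv h
      all_goals
        simp only [addr, Sum.elim_inl, Sum.elim_inr, append_singleton_suffix_append_singleton,
          Bool.true_eq_false, and_false, and_true] at hu hv
      refine ⟨(hlab u v hu hv h).1, ?_⟩
      rintro (w | w) hw
      · exact (hlab u v hu hv h).2 w fun hw' =>
          hw (append_singleton_suffix_append_singleton.2 ⟨hw', rfl⟩)
      · simp [eval]
  | relabel i j a ih =>
    obtain ⟨lab, hlab⟩ := ih s
    refine ⟨lab, fun u v hu hv h => ⟨?_, (hlab u v hu hv h).2⟩⟩
    simp only [eval, (hlab u v hu hv h).1]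
  | joinPos i j hij a ih =>
    obtain ⟨lab, hlab⟩ := ih s
    refine ⟨lab, fun u v hu hv h => ⟨(hlab u v hu hv h).1, fun w hw => ?_⟩⟩
    obtain ⟨hl, hw'⟩ := hlab u v hu hv h
    refine ⟨or_congr (hw' w hw).1 (joinEdges_adj_congr hl ?_ ?_), (hw' w hw).2⟩ <;>
    · rintro rfl; exact hw ‹_›
  | joinNeg i j hij a ih =>
    obtain ⟨lab, hlab⟩ := ih s
    refine ⟨lab, fun u v hu hv h => ⟨(hlab u v hu hv h).1, fun w hw => ?_⟩⟩
    obtain ⟨hl, hw'⟩ := hlab u v hu hv h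
    refine ⟨(hw' w hw).1, or_congr (hw' w hw).2 (joinEdges_adj_congr hl ?_ ?_)⟩ <;>
    · rintro rfl; exact hw ‹_›

end SignedExpr

namespace SignedExpr

variable {k : ℕ} {V : Type*}

/-- The parse tree of a signed `k`-expression is a branch-decomposition in which every edge has a
side with at most `k` different rows, for both signs. -/
lemma Generates.exists_branchDecomposition {e : SignedExpr k} {G : SignedGraph V}
    (h : e.Generates G) [Finite V] :
    ∃ D : BranchDecomposition V, ∀ s t, D.tree.Adj s t → ∃ U, (U = D.side s t ∨ U = D.side t s) ∧
      G.pos.RowsLE U k ∧ G.neg.RowsLE U k := by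
  obtain ⟨f, hpos, hneg⟩ := h
  have : Nonempty V := e.nonempty_eval_V.map f
  let A : LeafAddress V :=
    ⟨fun v => e.addr (f.symm v),
      fun u v huv => f.symm.injective (e.eq_of_addr_suffix _ _ huv),
      fun u hu b => (e.exists_suffix_addr _ hu b).imp' f fun v hv => by simpa using hv⟩
  refine ⟨A.toBranchDecomposition, fun s t hst => ?_⟩
  obtain ⟨a, ha⟩ := A.exists_side_eq_below hst
  obtain ⟨lab, hlab⟩ := e.exists_label_below a
  refine ⟨A.below a, ha.imp Eq.symm Eq.symm, ⟨lab ∘ f.symm, fun u hu v hv huv w hw => ?_⟩,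
    ⟨lab ∘ f.symm, fun u hu v hv huv w hw => ?_⟩⟩
  · simpa [hpos] using ((hlab _ _ hu hv huv).2 (f.symm w) hw).1
  · simpa [hneg] using ((hlab _ _ hu hv huv).2 (f.symm w) hw).2

/-- For every nonempty set of labels there is an expression for the edgeless graph with one vertex
for each of these labels. -/
lemma exists_edgeless (S : Finset (Fin k)) (hS : S.Nonempty) :
    ∃ e : SignedExpr k, Function.Injective e.eval.label ∧ Set.range e.eval.label = S ∧
      e.eval.graph = ⟨⊥, ⊥⟩ := by
  classical
  induction hS using Finset.Nonempty.cons_induction with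
  | singleton i =>
    exact ⟨vertex i, fun _ _ _ => rfl, by ext; simp [eval, eq_comm], rfl⟩
  | cons i S hi _ ih =>
    obtain ⟨e, hinj, hran, hgr⟩ := ih
    have hne : ∀ v, e.eval.label v ≠ i := fun v hv =>
      hi (by have := hran.subset ⟨v, hv⟩; simpa using this)
    refine ⟨union (vertex i) e, ?_, ?_, ?_⟩
    · rintro (u | u) (v | v) h
      · rfl
      · exact absurd h.symm (hne v)
      · exact absurd h (hne u)
      · rw [hinj h]
    · ext j
      have := Set.ext_iff.1 hran j
      simp_all [eval, eq_comm]
    · have hbot : (⊥ : SimpleGraph Unit) ⊕g (⊥ : SimpleGraph e.eval.V) = ⊥ := by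
        ext (u | u) (v | v) <;> simp
      change (⟨(⊥ : SimpleGraph Unit) ⊕g e.eval.graph.pos, (⊥ : SimpleGraph Unit) ⊕g
        e.eval.graph.neg⟩ : SignedGraph (Unit ⊕ e.eval.V)) = ⟨⊥, ⊥⟩
      simp only [hgr, hbot]

lemma sup_joinEdges_adj {V : Type} {label : V → Fin k} (hinj : Function.Injective label)
    {H : SimpleGraph V} {P : Finset (Fin k × Fin k)}
    (hH : ∀ u v, H.Adj u v ↔
      (SimpleGraph.fromRel fun i j => (i, j) ∈ P).Adj (label u) (label v))
    (i j : Fin k) (u v : V) :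
    (H ⊔ joinEdges label i j).Adj u v ↔
      (SimpleGraph.fromRel fun i' j' => (i', j') ∈ insert (i, j) P).Adj (label u) (label v) := by
  simp only [joinEdges, SimpleGraph.sup_adj, hH, SimpleGraph.fromRel_adj, ← hinj.ne_iff (x := u),
    Finset.mem_insert, Prod.mk.injEq]
  tauto

/-- If all labels are different, then a join adds a single edge, so every nonempty signed graph
whose vertices are the labels has an expression. -/
lemma exists_label_bijective (hk : 0 < k) (P N : Finset (Fin k × Fin k)) :
    ∃ e : SignedExpr k, Function.Bijective e.eval.label ∧
      (∀ u v, e.eval.graph.pos.Adj u v ↔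
        (SimpleGraph.fromRel fun i j => (i, j) ∈ P).Adj (e.eval.label u) (e.eval.label v)) ∧
      (∀ u v, e.eval.graph.neg.Adj u v ↔
        (SimpleGraph.fromRel fun i j => (i, j) ∈ N).Adj (e.eval.label u) (e.eval.label v)) := by
  classical
  induction P using Finset.induction with
  | empty =>
    induction N using Finset.induction with
    | empty =>
      obtain ⟨e, hinj, hran, hgr⟩ := exists_edgeless (Finset.univ : Finset (Fin k))
        ⟨⟨0, hk⟩, Finset.mem_univ _⟩
      exact ⟨e, ⟨hinj, Set.range_eq_univ.1 (by simpa using hran)⟩, by simp [hgr], by simp [hgr]⟩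
    | insert p N _ ih =>
      obtain ⟨i, j⟩ := p
      obtain ⟨e, hbij, hpos, hneg⟩ := ih
      by_cases hij : i = j
      · refine ⟨e, hbij, hpos, fun u v => (hneg u v).trans ?_⟩
        simp only [SimpleGraph.fromRel_adj, Finset.mem_insert, Prod.mk.injEq]
        grind
      · exact ⟨joinNeg i j hij e, hbij, hpos, sup_joinEdges_adj hbij.1 hneg i j⟩
  | insert p P _ ih =>
    obtain ⟨i, j⟩ := p
    obtain ⟨e, hbij, hpos, hneg⟩ := ih
    by_cases hij : i = j
    · refine ⟨e, hbij, fun u v => (hpos u v).trans ?_, hneg⟩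
      simp only [SimpleGraph.fromRel_adj, Finset.mem_insert, Prod.mk.injEq]
      grind
    · exact ⟨joinPos i j hij e, hbij, sup_joinEdges_adj hbij.1 hpos i j, hneg⟩

end SignedExpr

/-! ### Clique-width bounds rank-width -/

namespace SignedGraph

variable {V : Type*} (G : SignedGraph V)

lemma exists_generates [Finite V] [Nonempty V] : ∃ k, ∃ e : SignedExpr k, e.Generates G := by
  classical
  obtain ⟨k, ⟨g⟩⟩ := Finite.exists_equiv_fin V
  obtain ⟨v⟩ := ‹Nonempty V›
  obtain ⟨e, hbij, hpos, hneg⟩ := SignedExpr.exists_label_bijective (g v).pos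
    {p : Fin k × Fin k | G.pos.Adj (g.symm p.1) (g.symm p.2)}
    {p : Fin k × Fin k | G.neg.Adj (g.symm p.1) (g.symm p.2)}
  refine ⟨k, e, (Equiv.ofBijective _ hbij).trans g.symm, fun u v => (hpos u v).trans ?_,
    fun u v => (hneg u v).trans ?_⟩
  · simp only [SimpleGraph.fromRel_adj, Finset.mem_filter_univ, Equiv.trans_apply,
      Equiv.ofBijective_apply, G.pos.adj_comm (g.symm (e.eval.label v)), or_self,
      and_iff_right_iff_imp]
    intro h heq
    simp [heq] at h
  · simp only [SimpleGraph.fromRel_adj, Finset.mem_filter_univ, Equiv.trans_apply,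
      Equiv.ofBijective_apply, G.neg.adj_comm (g.symm (e.eval.label v)), or_self,
      and_iff_right_iff_imp]
    intro h heq
    simp [heq] at h

/-- The clique-width of a nonempty finite graph is attained. -/
lemma exists_generates_cliqueWidth [Finite V] [Nonempty V] :
    ∃ e : SignedExpr G.cliqueWidth, e.Generates G :=
  Nat.sInf_mem (s := {k | ∃ e : SignedExpr k, e.Generates G}) G.exists_generates

/-- The branch-width of a function on a nonempty finite set is attained. -/
lemma _root_.exists_width_eq_branchWidth [Finite V] [Nonempty V] (f : Set V → ℕ) :
    ∃ D : BranchDecomposition V, D.width f = branchWidth f := by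
  obtain ⟨k, e, he⟩ := (⟨⊥, ⊥⟩ : SignedGraph V).exists_generates
  obtain ⟨D, -⟩ := he.exists_branchDecomposition
  exact Nat.sInf_mem (s := {w | ∃ D : BranchDecomposition V, D.width f = w}) ⟨_, D, rfl⟩

theorem rankWidth_le_two_mul_cliqueWidth [Fintype V] : G.rankWidth ≤ 2 * G.cliqueWidth := by
  rcases isEmpty_or_nonempty V with hV | hV
  · refine (Nat.le_zero.2 ?_).trans (Nat.zero_le _)
    unfold rankWidth branchWidth
    rw [Nat.sInf_eq_zero]
    by_cases hD : Nonempty (BranchDecomposition V)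
    · obtain ⟨D⟩ := hD
      refine Or.inl ⟨D, Nat.le_zero.1 (D.width_le fun s t _ => ?_)⟩
      simp [cutRank, SimpleGraph.cutRank_of_isEmpty]
    · right
      ext w
      simp only [Set.mem_ofPred_eq, Set.mem_empty_iff_false, iff_false]
      rintro ⟨D, -⟩
      exact hD ⟨D⟩
  · obtain ⟨e, he⟩ := G.exists_generates_cliqueWidth
    obtain ⟨D, hD⟩ := he.exists_branchDecomposition
    refine (Nat.sInf_le ⟨D, rfl⟩ : G.rankWidth ≤ D.width G.cutRank).trans
      (D.width_le fun s t hst => ?_)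
    obtain ⟨U, hU, hpos, hneg⟩ := hD s t hst
    have hle : G.cutRank U ≤ 2 * G.cliqueWidth := by
      have h1 := hpos.cutRank_le
      have h2 := hneg.cutRank_le
      unfold cutRank
      omega
    rcases hU with rfl | rfl
    · exact hle
    · rw [← D.side_compl hst] at hle
      simpa only [cutRank, SimpleGraph.cutRank_compl] using hle

end SignedGraph

/-! ### Dot product graphs over `GF(2)` -/

/-- The differences of elements of `C` are orthogonal to `Z`, so the dimensions of the spans of these
differences and of `Z` add up to at most `t`. -/
lemma card_mul_card_le_of_dotProduct_eq {t : ℕ} (C Z : Finset (Fin t → ZMod 2))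
    (h : ∀ x ∈ C, ∀ x' ∈ C, ∀ z ∈ Z, x ⬝ᵥ z = x' ⬝ᵥ z) : C.card * Z.card ≤ 2 ^ t := by
  classical
  rcases C.eq_empty_or_nonempty with rfl | ⟨c, hc⟩
  · simp
  let D := Submodule.span (ZMod 2) ((fun x => x - c) '' (C : Set (Fin t → ZMod 2)))
  let W := Submodule.span (ZMod 2) (Z : Set (Fin t → ZMod 2))
  have hcard : ∀ E : Submodule (ZMod 2) (Fin t → ZMod 2),
      Nat.card E = 2 ^ Module.finrank (ZMod 2) E := fun E => by
    have : Fintype E := Fintype.ofFinite _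
    rw [Nat.card_eq_fintype_card, Module.card_eq_pow_finrank (K := ZMod 2), ZMod.card]
  have hle : D.map (dotProductEquiv (ZMod 2) (Fin t)).toLinearMap ≤ W.dualAnnihilator := by
    rw [Submodule.map_span, Submodule.span_le]
    rintro _ ⟨_, ⟨x, hx, rfl⟩, rfl⟩
    rw [SetLike.mem_coe, Submodule.mem_dualAnnihilator]
    intro w hw
    induction hw using Submodule.span_induction with
    | mem z hz =>
      simpa [sub_dotProduct, sub_eq_zero] using h x hx c hc z hz
    | zero => simp
    | add a b _ _ ha hb => rw [map_add, ha, hb, add_zero]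
    | smul r a _ ha => rw [map_smul, ha, smul_zero]
  have hdim : Module.finrank (ZMod 2) D + Module.finrank (ZMod 2) W ≤ t := by
    have h1 := Submodule.finrank_mono hle
    rw [LinearEquiv.finrank_map_eq] at h1
    have h2 := Subspace.finrank_add_finrank_dualAnnihilator_eq W
    rw [Module.finrank_fin_fun] at h2
    omega
  have hC : C.card ≤ Nat.card D := by
    rw [← Finset.card_image_of_injective C (sub_left_injective (b := c)), ← Set.ncard_coe_finset,
      Finset.coe_image]
    exact Set.ncard_le_ncard Submodule.subset_span (Set.toFinite _)
  have hZ : Z.card ≤ Nat.card W := by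
    rw [← Set.ncard_coe_finset]
    exact Set.ncard_le_ncard Submodule.subset_span (Set.toFinite _)
  calc C.card * Z.card ≤ Nat.card D * Nat.card W := Nat.mul_le_mul hC hZ
    _ = 2 ^ (Module.finrank (ZMod 2) D + Module.finrank (ZMod 2) W) := by
      rw [hcard, hcard, pow_add]
    _ ≤ 2 ^ t := Nat.pow_le_pow_right (by norm_num) hdim

lemma zmod_two_eq_iff (a b : ZMod 2) : a = b ↔ (a = 1 ↔ b = 1) := by
  revert a b; decide

namespace SimpleGraph

/-- A cut with at most `k` rows contains no dot product rectangle with more than `k * 2 ^ t`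
entries. -/
lemma RowsLE.ncard_mul_ncard_le {V : Type*} [Finite V] {G : SimpleGraph V} {U : Set V} {k t : ℕ}
    (h : G.RowsLE U k) {vec : V → Fin t → ZMod 2} {A B : Set V} (hA : A ⊆ U) (hB : B ⊆ Uᶜ)
    (hvA : Set.InjOn vec A) (hvB : Set.InjOn vec B)
    (hadj : ∀ a ∈ A, ∀ b ∈ B, G.Adj a b ↔ vec a ⬝ᵥ vec b = 1) :
    A.ncard * B.ncard ≤ k * 2 ^ t := by
  classical
  obtain ⟨lab, hlab⟩ := h
  have : Fintype V := Fintype.ofFinite V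
  have hfiber : ∀ l, (A.toFinset.filter fun a => lab a = l).card * B.toFinset.card ≤ 2 ^ t := by
    intro l
    rw [← Finset.card_image_of_injOn (s := A.toFinset.filter _) (f := vec),
      ← Finset.card_image_of_injOn (s := B.toFinset) (f := vec)]
    · refine card_mul_card_le_of_dotProduct_eq _ _ ?_
      simp only [Finset.mem_image, Finset.mem_filter, Set.mem_toFinset]
      rintro _ ⟨a, ⟨ha, rfl⟩, rfl⟩ _ ⟨a', ⟨ha', hl⟩, rfl⟩ _ ⟨b, hb, rfl⟩
      rw [zmod_two_eq_iff, ← hadj a ha b hb, ← hadj a' ha' b hb]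
      exact hlab a (hA ha) a' (hA ha') hl.symm b (hB hb)
    · simpa using hvB
    · exact hvA.mono fun a ha => by simpa using (Finset.mem_filter.1 ha).1
  rw [Set.ncard_eq_toFinset_card' A, Set.ncard_eq_toFinset_card' B,
    Finset.card_eq_sum_card_fiberwise (f := lab) (t := Finset.univ) (fun _ _ => by simp),
    Finset.sum_mul]
  exact (Finset.sum_le_sum fun l _ => hfiber l).trans (by simp)

/-- The bipartite graph `G` is given by the dot products of vectors over `GF(2)` attached to its
vertices. -/
structure IsDotProductGraph {P Q : Type*} (G : SimpleGraph (P ⊕ Q)) {t : ℕ}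
    (p : P → Fin t → ZMod 2) (q : Q → Fin t → ZMod 2) : Prop where
  adj_inl_inr : ∀ x y, G.Adj (.inl x) (.inr y) ↔ p x ⬝ᵥ q y = 1
  not_adj_inl : ∀ x x', ¬ G.Adj (.inl x) (.inl x')
  not_adj_inr : ∀ y y', ¬ G.Adj (.inr y) (.inr y')

namespace IsDotProductGraph

variable {P Q : Type*} {G : SimpleGraph (P ⊕ Q)} {t : ℕ} {p : P → Fin t → ZMod 2}
  {q : Q → Fin t → ZMod 2}

/-- The adjacency matrix of a dot product graph factors through `GF(2) ^ (2 * t)`. -/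
lemma cutRank_le [Fintype (P ⊕ Q)] (h : G.IsDotProductGraph p q) (U : Set (P ⊕ Q)) :
    G.cutRank U ≤ 2 * t := by
  classical
  let A : P ⊕ Q → Fin t ⊕ Fin t → ZMod 2 :=
    Sum.elim (fun x => Sum.elim (p x) 0) (fun y => Sum.elim 0 (q y))
  let B : P ⊕ Q → Fin t ⊕ Fin t → ZMod 2 :=
    Sum.elim (fun x => Sum.elim 0 (p x)) (fun y => Sum.elim (q y) 0)
  have hAB : ∀ u v, (if G.Adj u v then 1 else 0 : ZMod 2) = A u ⬝ᵥ B v := by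
    have hite : ∀ a : ZMod 2, (if a = 1 then 1 else 0) = a := by decide
    rintro (x | y) (x' | y')
    · simp [A, B, h.not_adj_inl]
    · simp [A, B, h.adj_inl_inr, hite]
    · rw [G.adj_comm]
      simp [A, B, h.adj_inl_inr, hite, dotProduct_comm]
    · simp [A, B, h.not_adj_inr]
  have hmul : G.cutMatrix U =
      (Matrix.of fun (u : U) i => A u i) * (Matrix.of fun i (w : (Uᶜ : Set (P ⊕ Q))) => B w i) := by
    ext u w
    simp only [cutMatrix, Matrix.of_apply, hAB, Matrix.mul_apply, dotProduct]
  rw [cutRank_eq_rank_cutMatrix, hmul]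
  refine (Matrix.rank_mul_le_left _ _).trans ((Matrix.rank_le_card_width _).trans ?_)
  simp [two_mul]

/-- Suppose that (almost) all vectors are used on both sides. If `U` and its complement both
contain a third of the right-hand vertices, then one of the two contains half of the left-hand
vertices, and these form a large rectangle in the cut with right-hand vertices of the other. -/
lemma two_pow_le_of_rowsLE [Finite P] [Finite Q] (h : G.IsDotProductGraph p q) (ht : t ≠ 0)
    (hp : Function.Injective p) (hq : Function.Injective q) (hP : 2 ^ t ≤ Nat.card P + 1)
    (hQ : Nat.card Q = 2 ^ t) {U : Set (P ⊕ Q)} {k : ℕ} (hU : G.RowsLE U k)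
    (h₁ : 2 ^ t ≤ 3 * (Set.range Sum.inr ∩ U).ncard)
    (h₂ : 2 ^ t ≤ 3 * (Set.range Sum.inr ∩ Uᶜ).ncard) : 2 ^ t ≤ 6 * k := by
  have hinl : Set.InjOn (Sum.elim p q) (Set.range Sum.inl) := by
    rintro _ ⟨x, rfl⟩ _ ⟨x', rfl⟩ hx
    exact congrArg _ (hp hx)
  have hinr : Set.InjOn (Sum.elim p q) (Set.range Sum.inr) := by
    rintro _ ⟨x, rfl⟩ _ ⟨x', rfl⟩ hx
    exact congrArg _ (hq hx)
  have hsum : (Set.range Sum.inl ∩ U).ncard + (Set.range Sum.inl ∩ Uᶜ).ncard = Nat.card P := by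
    rw [← Set.sdiff_eq, Set.ncard_inter_add_ncard_sdiff_eq_ncard, ← Set.image_univ,
      Set.ncard_image_of_injective _ Sum.inl_injective, Set.ncard_univ]
  have hrect₁ : (Set.range Sum.inl ∩ U).ncard * (Set.range Sum.inr ∩ Uᶜ).ncard ≤ k * 2 ^ t := by
    refine hU.ncard_mul_ncard_le (vec := Sum.elim p q) Set.inter_subset_right
      Set.inter_subset_right (hinl.mono Set.inter_subset_left) (hinr.mono Set.inter_subset_left) ?_
    rintro _ ⟨⟨x, rfl⟩, -⟩ _ ⟨⟨y, rfl⟩, -⟩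
    exact h.adj_inl_inr x y
  have hrect₂ : (Set.range Sum.inr ∩ U).ncard * (Set.range Sum.inl ∩ Uᶜ).ncard ≤ k * 2 ^ t := by
    refine hU.ncard_mul_ncard_le (vec := Sum.elim p q) Set.inter_subset_right
      Set.inter_subset_right (hinr.mono Set.inter_subset_left) (hinl.mono Set.inter_subset_left) ?_
    rintro _ ⟨⟨y, rfl⟩, -⟩ _ ⟨⟨x, rfl⟩, -⟩
    rw [G.adj_comm, h.adj_inl_inr, dotProduct_comm]
    rfl
  have hpos : 0 < 2 ^ t := by positivity
  have heven : 2 ∣ 2 ^ t := dvd_pow_self 2 ht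
  generalize 2 ^ t = n at *
  have key : ∀ a b : ℕ, n ≤ 2 * a → n ≤ 3 * b → a * b ≤ k * n → n ≤ 6 * k := by
    intro a b ha hb hab
    refine Nat.le_of_mul_le_mul_right ?_ hpos
    calc n * n ≤ (2 * a) * (3 * b) := Nat.mul_le_mul ha hb
      _ = 6 * (a * b) := by ring
      _ ≤ 6 * (k * n) := Nat.mul_le_mul_left _ hab
      _ = 6 * k * n := by ring
  by_cases hhalf : n ≤ 2 * (Set.range Sum.inl ∩ U).ncard
  · exact key _ _ hhalf h₂ hrect₁
  · rw [mul_comm] at hrect₂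
    exact key _ _ (by omega) h₁ hrect₂

end IsDotProductGraph

end SimpleGraph

/-! ### The formula of the dot product -/

namespace CNFFormula

open SimpleGraph

/-- A numbering of the vectors of `GF(2) ^ t`, which serve as variables. -/
noncomputable def vecCode (t : ℕ) (x : Fin t → ZMod 2) : ℕ := Finite.equivFin (Fin t → ZMod 2) x

lemma vecCode_injective (t : ℕ) : Function.Injective (vecCode t) :=
  Fin.val_injective.comp (Equiv.injective _)

/-- The clause of the (positive) variables `x` with `x ⬝ᵥ y = 1`. -/
noncomputable def dotClause {t : ℕ} (y : Fin t → ZMod 2) : Finset (ℕ × Bool) :=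
  (Finset.univ.filter fun x => x ⬝ᵥ y = 1).image fun x => (vecCode t x, true)

lemma vecCode_mem_dotClause {t : ℕ} {x y : Fin t → ZMod 2} :
    (vecCode t x, true) ∈ dotClause y ↔ x ⬝ᵥ y = 1 := by
  simp [dotClause, (vecCode_injective t).eq_iff]

lemma exists_of_mem_dotClause {t : ℕ} {y : Fin t → ZMod 2} {l : ℕ × Bool} (h : l ∈ dotClause y) :
    ∃ x, l = (vecCode t x, true) := by
  obtain ⟨x, -, rfl⟩ := Finset.mem_image.1 h
  exact ⟨x, rfl⟩

lemma dotClause_injective (t : ℕ) :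
    Function.Injective (dotClause : (Fin t → ZMod 2) → Finset (ℕ × Bool)) := by
  intro y y' h
  refine dotProduct_eq _ _ fun x => ?_
  rw [zmod_two_eq_iff, dotProduct_comm, ← vecCode_mem_dotClause, h, vecCode_mem_dotClause,
    dotProduct_comm]

/-- The formula with a clause `{x | x ⬝ᵥ y = 1}` for each vector `y` of `GF(2) ^ t`. Its variables
are the nonzero vectors. -/
noncomputable def dotFormula (t : ℕ) : CNFFormula ℕ :=
  Finset.univ.image (dotClause : (Fin t → ZMod 2) → Finset (ℕ × Bool))

variable {t : ℕ}

lemma exists_dotClause_eq (c : (dotFormula t).Clause) : ∃ y : Fin t → ZMod 2, dotClause y = c.1 := by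
  obtain ⟨y, -, hy⟩ := Finset.mem_image.1 c.2
  exact ⟨y, hy⟩

lemma exists_vecCode_eq (v : (dotFormula t).Var) : ∃ x, vecCode t x = v.1 := by
  obtain ⟨c, hc, b, hb⟩ := v.2
  obtain ⟨y, rfl⟩ := exists_dotClause_eq ⟨c, hc⟩
  obtain ⟨x, hx⟩ := exists_of_mem_dotClause hb
  exact ⟨x, (congrArg Prod.fst hx).symm⟩

/-- The vector of a variable. -/
noncomputable def varVec (v : (dotFormula t).Var) : Fin t → ZMod 2 := (exists_vecCode_eq v).choose

/-- The vector of a clause. -/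
noncomputable def clauseVec (c : (dotFormula t).Clause) : Fin t → ZMod 2 :=
  (exists_dotClause_eq c).choose

lemma vecCode_varVec (v : (dotFormula t).Var) : vecCode t (varVec v) = v.1 :=
  (exists_vecCode_eq v).choose_spec

lemma dotClause_clauseVec (c : (dotFormula t).Clause) : dotClause (clauseVec c) = c.1 :=
  (exists_dotClause_eq c).choose_spec

lemma varVec_injective : Function.Injective (varVec (t := t)) := fun v v' h =>
  Subtype.ext (by rw [← vecCode_varVec, h, vecCode_varVec])

lemma clauseVec_injective : Function.Injective (clauseVec (t := t)) := fun c c' h =>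
  Subtype.ext (by rw [← dotClause_clauseVec, h, dotClause_clauseVec])

lemma noComplementaryLiterals_dotFormula : (dotFormula t).NoComplementaryLiterals := by
  rintro c hc x ⟨-, h⟩
  obtain ⟨y, rfl⟩ := exists_dotClause_eq ⟨c, hc⟩
  obtain ⟨x', hx'⟩ := exists_of_mem_dotClause h
  simpa using congrArg Prod.snd hx'

lemma isDotProductGraph_dotFormula :
    (dotFormula t).signedGraph.pos.IsDotProductGraph varVec clauseVec where
  adj_inl_inr v c := by
    rw [← vecCode_mem_dotClause, vecCode_varVec, dotClause_clauseVec]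
    rfl
  not_adj_inl _ _ h := h
  not_adj_inr _ _ h := h

lemma neg_signedGraph_dotFormula : (dotFormula t).signedGraph.neg = ⊥ := by
  have hmem : ∀ (c : (dotFormula t).Clause) (n : ℕ), (n, false) ∉ c.1 := by
    intro c n h
    rw [← dotClause_clauseVec] at h
    obtain ⟨x, hx⟩ := exists_of_mem_dotClause h
    simpa using congrArg Prod.snd hx
  ext (v | c) (v' | c')
  · exact iff_of_false id id
  · exact iff_of_false (hmem c' _) id
  · exact iff_of_false (hmem c _) id
  · exact iff_of_false id id

lemma card_clause_dotFormula : Nat.card (dotFormula t).Clause = 2 ^ t := by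
  change Nat.card {c // c ∈ dotFormula t} = 2 ^ t
  rw [Nat.card_eq_fintype_card, Fintype.card_coe, dotFormula,
    Finset.card_image_of_injective _ (dotClause_injective t)]
  simp

lemma two_pow_le_card_var_dotFormula : 2 ^ t ≤ Nat.card (dotFormula t).Var + 1 := by
  have hocc : ∀ x : {x : Fin t → ZMod 2 // x ≠ 0},
      ∃ c ∈ dotFormula t, ∃ b : Bool, (vecCode t x.1, b) ∈ c := by
    rintro ⟨x, hx⟩
    obtain ⟨i, hi⟩ := Function.ne_iff.1 hx
    refine ⟨dotClause (Pi.single i 1), Finset.mem_image_of_mem _ (Finset.mem_univ _), true,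
      vecCode_mem_dotClause.2 ?_⟩
    have h01 : ∀ a : ZMod 2, a ≠ 0 → a = 1 := by decide
    simpa using h01 _ hi
  let f : {x : Fin t → ZMod 2 // x ≠ 0} → (dotFormula t).Var := fun x => ⟨vecCode t x.1, hocc x⟩
  have hf : Function.Injective f := fun x x' h =>
    Subtype.ext (vecCode_injective t (congrArg Subtype.val h))
  have hle := Nat.card_le_card_of_injective f hf
  rw [Nat.card_eq_fintype_card (α := {x : Fin t → ZMod 2 // x ≠ 0}),
    Fintype.card_subtype_compl] at hle
  simp at hle
  omega

instance : Nonempty (dotFormula t).Vertex :=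
  ⟨.inr ⟨dotClause 0, Finset.mem_image_of_mem _ (Finset.mem_univ _)⟩⟩

lemma rankWidth_dotFormula_le : (dotFormula t).rankWidth ≤ 2 * t := by
  obtain ⟨D, hD⟩ := exists_width_eq_branchWidth (dotFormula t).signedGraph.cutRank
  change branchWidth (dotFormula t).signedGraph.cutRank ≤ _
  rw [← hD]
  refine D.width_le fun s t' _ => ?_
  rw [SignedGraph.cutRank, neg_signedGraph_dotFormula, cutRank_bot, add_zero]
  exact isDotProductGraph_dotFormula.cutRank_le _

/-- A balanced edge of a branch-decomposition of the graph of `dotFormula t` has, in both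
directions, at least `2 ^ t / 6` different rows. -/
lemma exists_adj_forall_rowsLE (ht : 2 ≤ t) (D : BranchDecomposition (dotFormula t).Vertex) :
    ∃ s s', D.tree.Adj s s' ∧ ∀ U, (U = D.side s s' ∨ U = D.side s' s) → ∀ k,
      (dotFormula t).signedGraph.pos.RowsLE U k → 2 ^ t ≤ 6 * k := by
  have hS : (Set.range (Sum.inr : _ → (dotFormula t).Vertex)).ncard = 2 ^ t := by
    rw [← Set.image_univ, Set.ncard_image_of_injective _ Sum.inr_injective, Set.ncard_univ,
      card_clause_dotFormula]
  have h4 : 4 ≤ 2 ^ t := Nat.pow_le_pow_right (n := 2) (by norm_num) ht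
  obtain ⟨s, s', hadj, h₁, h₂⟩ := D.exists_balanced_edge (Set.toFinite _) (h4.trans_eq hS.symm)
  rw [hS] at h₁ h₂
  have key := fun U k hU => isDotProductGraph_dotFormula.two_pow_le_of_rowsLE (t := t) (U := U)
    (k := k) (by omega) varVec_injective clauseVec_injective two_pow_le_card_var_dotFormula
    card_clause_dotFormula hU
  refine ⟨s, s', hadj, ?_⟩
  rintro U (rfl | rfl) k hU
  · exact key _ k hU h₁ (by rwa [D.side_compl hadj])
  · exact key _ k hU h₂ (by rwa [D.side_compl hadj.symm])

lemma two_pow_le_cliqueWidth_dotFormula (ht : 2 ≤ t) :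
    2 ^ t ≤ 6 * (dotFormula t).cliqueWidth := by
  obtain ⟨e, he⟩ := (dotFormula t).signedGraph.exists_generates_cliqueWidth
  obtain ⟨D, hD⟩ := he.exists_branchDecomposition
  obtain ⟨s, s', hadj, hrows⟩ := exists_adj_forall_rowsLE ht D
  obtain ⟨U, hU, hpos, -⟩ := hD s s' hadj
  exact hrows U hU _ hpos

lemma le_rankWidth_dotFormula (ht : 2 ≤ t) : t ≤ (dotFormula t).rankWidth + 2 := by
  obtain ⟨D, hD⟩ := exists_width_eq_branchWidth (dotFormula t).signedGraph.cutRank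
  obtain ⟨s, s', hadj, hrows⟩ := exists_adj_forall_rowsLE ht D
  have hle := D.le_width (dotFormula t).signedGraph.cutRank hadj
  rw [hD] at hle
  have h := hrows _ (Or.inl rfl) _ (rowsLE_two_pow_cutRank _)
  have hlt : 2 ^ t < 2 ^ ((dotFormula t).rankWidth + 3) := by
    calc 2 ^ t ≤ 6 * 2 ^ (dotFormula t).signedGraph.pos.cutRank (D.side s s') := h
      _ ≤ 6 * 2 ^ (dotFormula t).rankWidth :=
        Nat.mul_le_mul_left _ (Nat.pow_le_pow_right (by norm_num)
          ((Nat.le_add_right _ _).trans hle))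
      _ < 2 ^ ((dotFormula t).rankWidth + 3) := by
        have := Nat.two_pow_pos (dotFormula t).rankWidth
        rw [pow_add]
        omega
  have := (Nat.pow_lt_pow_iff_right (by norm_num)).1 hlt
  omega

end CNFFormula

/-! ### Comparison of the two widths -/

theorem proposition6 :
    (∀ {α : Type*} (φ : CNFFormula α), φ.rankWidth ≤ 2 * φ.cliqueWidth) ∧
    (∀ N : ℕ, ∃ φ : CNFFormula ℕ, φ.NoComplementaryLiterals ∧ N ≤ φ.rankWidth ∧
      (2 : ℝ) ^ ((φ.rankWidth : ℝ) / 4 - 1) ≤ (φ.cliqueWidth : ℝ)) := by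
  refine ⟨fun φ => φ.signedGraph.rankWidth_le_two_mul_cliqueWidth, fun N => ?_⟩
  have hlow := CNFFormula.le_rankWidth_dotFormula (t := N + 4) (by omega)
  have hup := CNFFormula.rankWidth_dotFormula_le (t := N + 4)
  have hcwd := CNFFormula.two_pow_le_cliqueWidth_dotFormula (t := N + 4) (by omega)
  refine ⟨CNFFormula.dotFormula (N + 4), CNFFormula.noComplementaryLiterals_dotFormula,
    by omega, ?_⟩
  generalize (CNFFormula.dotFormula (N + 4)).rankWidth = r at *
  generalize (CNFFormula.dotFormula (N + 4)).cliqueWidth = k at *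
  have hexp : (r : ℝ) / 4 - 1 ≤ ((N + 1 : ℕ) : ℝ) := by
    have : (r : ℝ) ≤ 2 * (N + 4) := by exact_mod_cast hup
    push_cast
    have : (0 : ℝ) ≤ N := N.cast_nonneg
    linarith
  have hpow : 2 ^ (N + 1) ≤ k := by
    rw [pow_add] at hcwd ⊢
    omega
  calc (2 : ℝ) ^ ((r : ℝ) / 4 - 1) ≤ 2 ^ ((N + 1 : ℕ) : ℝ) :=
        Real.rpow_le_rpow_of_exponent_le (by norm_num) hexp
    _ = ((2 ^ (N + 1) : ℕ) : ℝ) := by rw [Real.rpow_natCast]; push_cast; rfl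
    _ ≤ k := by exact_mod_cast hpow
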